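/- For a complex $3\times 3$ matrix $A$ write $A'$ for its transpose and $A^*$ for its adjugate, and call two matrices $A,B$ congruent if $B=T'AT$ for some $T\in \mathrm{SO}(3,\mathbb{C})=\{T : TT'=I_3,\ \det T=1\}$. A matrix $A\in M_3(\mathbb{C})$ satisfies $$A'\bigl((\mathrm{tr}(A)+1)I_3-A\bigr)=A^*$$ if and only if it is congruent to one of the following matrices (where $i=\sqrt{-1}$): $$0;\qquad -I_3;\qquad \begin{pmatrix}-1&0&0\\0&-\frac{1+i}{2}&\frac{i-1}{2}\\0&-\frac{1+i}{2}&\frac{i-1}{2}\end{pmatrix};\qquad \begin{pmatrix}k&0&0\\0&-\frac12&\frac i2\\0&-\frac i2&-\frac12\end{pmatrix},\ k\in\mathbb{C};\qquad \begin{pmatrix}-\frac12+i&1-\frac i2&0\\1+\frac i2&-\frac12-i&0\\0&0&0\end{pmatrix}.$$ No two different matrices in this list are congruent, so the list is a complete list of representatives, without repetition, of the congruence classes of solutions. The third matrix has rank $2$ and the last one has rank $1$. Congruent matrices have equal traces, and different members of the family (different values of $k$) have different traces. -/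

import Mathlib

open scoped Matrix

noncomputable section

/-- The matrix equation `A' ((tr A + 1) I - A) = A*` for a complex `3 × 3` matrix `A`, where `A'`
is the transpose and `A*` the adjugate of `A`. -/
def IsSolution (A : Matrix (Fin 3) (Fin 3) ℂ) : Prop :=
  Aᵀ * ((A.trace + 1) • (1 : Matrix (Fin 3) (Fin 3) ℂ) - A) = A.adjugate

/-- `B` is congruent to `A` under the complex special orthogonal group `SO(3, ℂ)`
(transpose, not conjugate transpose): `B = T' A T` for some `T` with `T T' = 1`, `det T = 1`. -/
def SOCongruent (A B : Matrix (Fin 3) (Fin 3) ℂ) : Prop :=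
  ∃ T ∈ Matrix.specialOrthogonalGroup (Fin 3) ℂ, B = Tᵀ * A * T

/-- Labels for the entries of the list of representatives. -/
inductive RepLabel : Type
  | zero : RepLabel
  | negOne : RepLabel
  | rankTwo : RepLabel
  | family (k : ℂ) : RepLabel
  | rankOne : RepLabel

/-- The list of representatives. -/
def RepLabel.toMatrix : RepLabel → Matrix (Fin 3) (Fin 3) ℂ
  | .zero => !![0, 0, 0;
                0, 0, 0;
                0, 0, 0]
  | .negOne => !![-1, 0, 0;
                  0, -1, 0;
                  0, 0, -1]
  | .rankTwo => !![-1, 0, 0;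
                   0, -((1 + Complex.I) / 2), (Complex.I - 1) / 2;
                   0, -((1 + Complex.I) / 2), (Complex.I - 1) / 2]
  | .family k => !![k, 0, 0;
                    0, -(1 / 2), Complex.I / 2;
                    0, -(Complex.I / 2), -(1 / 2)]
  | .rankOne => !![-(1 / 2) + Complex.I, 1 - Complex.I / 2, 0;
                   1 + Complex.I / 2, -(1 / 2) - Complex.I, 0;
                   0, 0, 0]

end

/-! Let `a` be the axial vector of `A - Aᵀ` and `t` the trace. The equation makes `a` an eigenvector
of `A + Aᵀ`, and `A - Aᵀ` kills `a`, so `A a = Aᵀ a = (t + 1) a`. If `a = 0`, then `A` is symmetric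
and turns out to be scalar (`IsSolution.eq_zero_or_neg_one`). Otherwise, applying the equation to
`a` gives `a ⬝ᵥ a = -1`, and a rotation takes `a` to `(-i, 0, 0)`. Then `A` is a number `k` plus a 2
× 2 block with parameters `p, q` (`IsSolution.exists_blockForm`). Rotations about the first axis
normalise `p, q`.

Trace separates the representatives, except for coincidences with the family; those are settled
directly or by a quadratic relation on `A + Aᵀ`. -/

open Matrix Complex

/-! ### Congruence and its invariants -/

namespace SOCongruent

theorem refl (A : Matrix (Fin 3) (Fin 3) ℂ) : SOCongruent A A :=
  ⟨1, one_mem _, by simp⟩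

theorem of_mul_transpose {A B T : Matrix (Fin 3) (Fin 3) ℂ} (h : Tᵀ * T = 1) (hd : T.det = 1)
    (hB : B = Tᵀ * A * T) : SOCongruent A B := by
  refine ⟨T, ?_, hB⟩
  rw [Matrix.mem_specialOrthogonalGroup_iff, Matrix.mem_orthogonalGroup_iff']
  exact ⟨h, hd⟩

theorem exists_transpose {A B : Matrix (Fin 3) (Fin 3) ℂ} (h : SOCongruent A B) :
    ∃ T : Matrix (Fin 3) (Fin 3) ℂ, Tᵀ * T = 1 ∧ T * Tᵀ = 1 ∧ T.det = 1 ∧ B = Tᵀ * A * T := by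
  obtain ⟨T, hT, hB⟩ := h
  rw [Matrix.mem_specialOrthogonalGroup_iff] at hT
  exact ⟨T, (Matrix.mem_orthogonalGroup_iff' _ _).1 hT.1, (Matrix.mem_orthogonalGroup_iff _ _).1 hT.1,
    hT.2, hB⟩

theorem symm {A B : Matrix (Fin 3) (Fin 3) ℂ} (h : SOCongruent A B) : SOCongruent B A := by
  obtain ⟨T, h1, h2, hd, rfl⟩ := h.exists_transpose
  refine of_mul_transpose (T := Tᵀ) (by simpa using h2) (by simpa using hd) ?_
  calc A = (T * Tᵀ) * A * (T * Tᵀ) := by simp [h2]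
    _ = _ := by simp only [transpose_transpose, Matrix.mul_assoc]

theorem trans {A B C : Matrix (Fin 3) (Fin 3) ℂ} (h : SOCongruent A B) (h' : SOCongruent B C) :
    SOCongruent A C := by
  obtain ⟨T, hT, rfl⟩ := h
  obtain ⟨U, hU, rfl⟩ := h'
  exact ⟨T * U, mul_mem hT hU, by simp only [transpose_mul, Matrix.mul_assoc]⟩

theorem trace_eq {A B : Matrix (Fin 3) (Fin 3) ℂ} (h : SOCongruent A B) : A.trace = B.trace := by
  obtain ⟨T, -, h2, -, rfl⟩ := h.exists_transpose
  rw [Matrix.mul_assoc, trace_mul_comm, Matrix.mul_assoc, h2, Matrix.mul_one]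

theorem isSolution {A B : Matrix (Fin 3) (Fin 3) ℂ} (h : SOCongruent A B) (hA : IsSolution A) :
    IsSolution B := by
  have ht := h.trace_eq
  obtain ⟨T, h1, h2, hd, rfl⟩ := h.exists_transpose
  -- For `T` in SO(3) the adjugate is the inverse, so both sides of the equation transform by the
  -- same conjugation.
  have hadj : T.adjugate = Tᵀ := by
    calc T.adjugate = T.adjugate * (T * Tᵀ) := by rw [h2, Matrix.mul_one]
      _ = Tᵀ := by rw [← Matrix.mul_assoc, adjugate_mul, hd, one_smul, Matrix.one_mul]
  unfold IsSolution at hA ⊢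
  rw [← ht, adjugate_mul_distrib, adjugate_mul_distrib, ← adjugate_transpose, hadj, ← hA,
    transpose_transpose]
  have : (A.trace + 1) • (1 : Matrix (Fin 3) (Fin 3) ℂ) - Tᵀ * A * T =
      Tᵀ * ((A.trace + 1) • (1 : Matrix (Fin 3) (Fin 3) ℂ) - A) * T := by
    simp [Matrix.mul_sub, Matrix.sub_mul, h1]
  rw [this]
  simp only [transpose_mul, transpose_transpose, Matrix.mul_assoc]
  rw [← Matrix.mul_assoc T, h2, Matrix.one_mul]

/-- A quadratic relation satisfied by the symmetric part is invariant under congruence. -/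
theorem symmetric_part_relation {A B : Matrix (Fin 3) (Fin 3) ℂ} (h : SOCongruent A B) (c : ℂ)
    (hA : (A + Aᵀ + c • 1) * (A + Aᵀ + (1 : Matrix (Fin 3) (Fin 3) ℂ)) = 0) :
    (B + Bᵀ + c • 1) * (B + Bᵀ + (1 : Matrix (Fin 3) (Fin 3) ℂ)) = 0 := by
  obtain ⟨T, h1, h2, -, rfl⟩ := h.exists_transpose
  have key (c : ℂ) : Tᵀ * A * T + (Tᵀ * A * T)ᵀ + c • 1 = Tᵀ * (A + Aᵀ + c • 1) * T := by
    simp [Matrix.mul_add, Matrix.add_mul, h1, Matrix.mul_assoc]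
  have k1 := key 1
  rw [one_smul] at k1
  rw [key, k1]
  calc _ = Tᵀ * ((A + Aᵀ + c • 1) * ((T * Tᵀ) * (A + Aᵀ + 1))) * T := by
        simp only [Matrix.mul_assoc]
    _ = 0 := by rw [h2, Matrix.one_mul, hA]; simp

end SOCongruent

theorem RepLabel.isSolution_toMatrix (r : RepLabel) : IsSolution r.toMatrix := by
  unfold IsSolution
  rw [adjugate_fin_three]
  cases r <;> ext i j <;> fin_cases i <;> fin_cases j <;>
    simp [RepLabel.toMatrix, Matrix.mul_apply, Fin.sum_univ_three, trace_fin_three] <;>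
    ring_nf <;> (try simp only [I_sq]) <;> (try ring_nf)

/-! ### Identities for the axial vector -/

/-- The axial vector of twice the antisymmetric part. -/
def axialVector (A : Matrix (Fin 3) (Fin 3) ℂ) : Fin 3 → ℂ :=
  ![A 2 1 - A 1 2, A 0 2 - A 2 0, A 1 0 - A 0 1]

theorem IsSolution.apply {A : Matrix (Fin 3) (Fin 3) ℂ} (h : IsSolution A) (i j : Fin 3) :
    (Aᵀ * ((A.trace + 1) • (1 : Matrix (Fin 3) (Fin 3) ℂ) - A)) i j = A.adjugate i j := by
  rw [show _ = _ from h]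

theorem IsSolution.entries {A : Matrix (Fin 3) (Fin 3) ℂ} (h : IsSolution A) :
    A 0 0 * (A 1 1 + A 2 2 + 1) - A 1 0 ^ 2 - A 2 0 ^ 2 = A 1 1 * A 2 2 - A 1 2 * A 2 1 ∧
    A 1 0 * (A 0 0 + A 2 2 + 1) - A 0 0 * A 0 1 - A 2 0 * A 2 1 =
      -(A 0 1 * A 2 2) + A 0 2 * A 2 1 ∧
    A 2 0 * (A 0 0 + A 1 1 + 1) - A 0 0 * A 0 2 - A 1 0 * A 1 2 =
      A 0 1 * A 1 2 - A 0 2 * A 1 1 ∧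
    A 0 1 * (A 1 1 + A 2 2 + 1) - A 1 1 * A 1 0 - A 2 1 * A 2 0 =
      -(A 1 0 * A 2 2) + A 1 2 * A 2 0 ∧
    A 1 1 * (A 0 0 + A 2 2 + 1) - A 0 1 ^ 2 - A 2 1 ^ 2 = A 0 0 * A 2 2 - A 0 2 * A 2 0 ∧
    A 2 1 * (A 0 0 + A 1 1 + 1) - A 0 1 * A 0 2 - A 1 1 * A 1 2 =
      -(A 0 0 * A 1 2) + A 0 2 * A 1 0 ∧
    A 0 2 * (A 1 1 + A 2 2 + 1) - A 1 2 * A 1 0 - A 2 2 * A 2 0 =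
      A 1 0 * A 2 1 - A 1 1 * A 2 0 ∧
    A 1 2 * (A 0 0 + A 2 2 + 1) - A 0 2 * A 0 1 - A 2 2 * A 2 1 =
      -(A 0 0 * A 2 1) + A 0 1 * A 2 0 ∧
    A 2 2 * (A 0 0 + A 1 1 + 1) - A 0 2 ^ 2 - A 1 2 ^ 2 = A 0 0 * A 1 1 - A 0 1 * A 1 0 := by
  have e := h.apply
  rw [adjugate_fin_three] at e
  have e00 := e 0 0
  have e01 := e 0 1
  have e02 := e 0 2
  have e10 := e 1 0
  have e11 := e 1 1
  have e12 := e 1 2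
  have e20 := e 2 0
  have e21 := e 2 1
  have e22 := e 2 2
  simp [Matrix.mul_apply, Fin.sum_univ_three, trace_fin_three] at e00 e01 e02 e10 e11 e12 e20 e21 e22
  refine ⟨?_, ?_, ?_, ?_, ?_, ?_, ?_, ?_, ?_⟩
  · linear_combination e00
  · linear_combination e01
  · linear_combination e02
  · linear_combination e10
  · linear_combination e11
  · linear_combination e12
  · linear_combination e20
  · linear_combination e21
  · linear_combination e22

/-- The symmetric part of a solution has the axial vector as an eigenvector. -/
theorem IsSolution.mulVec_axialVector {A : Matrix (Fin 3) (Fin 3) ℂ} (h : IsSolution A) :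
    (A + Aᵀ) *ᵥ axialVector A = (2 * (A.trace + 1)) • axialVector A := by
  obtain ⟨e00, e01, e02, e10, e11, e12, e20, e21, e22⟩ := h.entries
  ext i
  fin_cases i <;>
    simp [axialVector, Matrix.mulVec, dotProduct, Fin.sum_univ_three, trace_fin_three]
  · linear_combination 2 * e21 - 2 * e12
  · linear_combination 2 * e02 - 2 * e20
  · linear_combination 2 * e10 - 2 * e01

/-- The second elementary symmetric function of the eigenvalues of a solution. -/
theorem IsSolution.trace_adjugate {A : Matrix (Fin 3) (Fin 3) ℂ} (h : IsSolution A) :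
    A.adjugate.trace = axialVector A ⬝ᵥ axialVector A - A.trace := by
  obtain ⟨e00, e01, e02, e10, e11, e12, e20, e21, e22⟩ := h.entries
  rw [adjugate_fin_three]
  simp [axialVector, dotProduct, Fin.sum_univ_three, trace_fin_three]
  linear_combination e00 + e11 + e22

/-- Cayley–Hamilton with one factor `A` cancelled; as a polynomial identity it also covers singular
`A`. -/
theorem adjugate_eq_cayley (A : Matrix (Fin 3) (Fin 3) ℂ) :
    A.adjugate = A * A - A.trace • A + A.adjugate.trace • 1 := by
  rw [adjugate_fin_three]
  ext i j
  fin_cases i <;> fin_cases j <;>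
    simp [Matrix.mul_apply, Fin.sum_univ_three, trace_fin_three] <;> ring

/-- For symmetric `A` the equation becomes quadratic in `A`. Reducing `A * adj A = det A` by it
leaves `A` with the nonzero coefficient 1/4, so `A` is scalar. -/
theorem IsSolution.eq_zero_or_neg_one {A : Matrix (Fin 3) (Fin 3) ℂ} (h : IsSolution A)
    (ha : axialVector A = 0) : A = 0 ∨ A = -1 := by
  have hs : A.adjugate.trace = -A.trace := by simp [h.trace_adjugate, ha]
  have hsym : Aᵀ = A := by
    have h0 := congrFun ha 0
    have h1 := congrFun ha 1
    have h2 := congrFun ha 2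
    simp [axialVector, sub_eq_zero] at h0 h1 h2
    ext i j
    fin_cases i <;> fin_cases j <;> simp [h0, h1, h2]
  have hc := adjugate_eq_cayley A
  have hd := mul_adjugate A
  rw [hs] at hc
  unfold IsSolution at h
  rw [hsym, hc] at h
  rw [hc] at hd
  set t := A.trace
  set d := A.det
  simp only [Matrix.mul_sub, Matrix.mul_add, Matrix.mul_smul, Matrix.mul_one] at h hd
  have h2 : A * A = (t + 1 / 2) • A + (t / 2) • 1 := by
    have : (2 : ℂ) • (A * A) = (2 : ℂ) • ((t + 1 / 2) • A + (t / 2) • 1) := by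
      linear_combination (norm := module) (-1 : ℂ) • h
    exact smul_right_injective _ two_ne_zero this
  have h3 : A * (A * A) = (t + 1 / 2) • (A * A) + (t / 2) • A := by
    conv_lhs => rw [h2]
    simp [Matrix.mul_add]
  have hA : A = (4 * d - t) • 1 := by
    rw [h3, h2] at hd
    linear_combination (norm := module) (4 : ℂ) • hd
  obtain ⟨p, hp⟩ : ∃ p : ℂ, A = p • 1 := ⟨_, hA⟩
  have ht : t = 3 * p := by simp [t, hp, trace_fin_three]; ring
  have h00 := congrFun (congrFun h2 0) 0
  rw [ht, hp] at h00
  simp at h00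
  have : p * (p + 1) = 0 := by linear_combination (-1 / 2 : ℂ) * h00
  rcases mul_eq_zero.1 this with h' | h'
  · left; rw [hp, h', zero_smul]
  · right; rw [hp, eq_neg_of_add_eq_zero_left h', neg_one_smul]

theorem IsSolution.axialVector_dotProduct_self {A : Matrix (Fin 3) (Fin 3) ℂ} (h : IsSolution A)
    (ha : axialVector A ≠ 0) : axialVector A ⬝ᵥ axialVector A = -1 := by
  have hs := h.trace_adjugate
  have hc := adjugate_eq_cayley A
  have hv := h.mulVec_axialVector
  -- The antisymmetric part acts as a cross product with `a`, hence kills `a`.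
  have hK : Aᵀ *ᵥ axialVector A = A *ᵥ axialVector A := by
    ext i
    fin_cases i <;> simp [axialVector, Matrix.mulVec, dotProduct, Fin.sum_univ_three] <;> ring
  unfold IsSolution at h
  rw [hc] at h
  set a := axialVector A
  set t := A.trace
  set s := A.adjugate.trace
  have hA : A *ᵥ a = (t + 1) • a := by
    rw [Matrix.add_mulVec, hK] at hv
    linear_combination (norm := module) (1 / 2 : ℂ) • hv
  rw [hA] at hK
  have h' := congrArg (· *ᵥ a) h
  simp only [Matrix.mul_sub, Matrix.sub_mulVec, Matrix.add_mulVec, Matrix.mul_smul, Matrix.mul_one,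
    Matrix.smul_mulVec, ← Matrix.mulVec_mulVec, hA, hK, Matrix.mulVec_smul, Matrix.one_mulVec] at h'
  -- The left side of the equation kills `a`, while the adjugate acts on it by `(t + 1)² - t (t + 1)
  -- + s`.
  have h0 : (s + t + 1) • a = 0 := by
    linear_combination (norm := module) -h'
  have := (smul_eq_zero.1 h0).resolve_right ha
  linear_combination this - hs

/-! ### Rotating the axial vector -/

/-- A complex vector of square one is the first column of a special orthogonal matrix. -/
theorem exists_completion (u : Fin 3 → ℂ) (hu : u ⬝ᵥ u = 1) :
    ∃ v : Fin 3 → ℂ, u ⬝ᵥ v = 0 ∧ v ⬝ᵥ v = 1 := by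
  simp only [dotProduct, Fin.sum_univ_three] at hu ⊢
  have key (a b : ℂ) (h : a * a + b * b ≠ 0) : ∃ r : ℂ, r * r * (a * a + b * b) = 1 := by
    obtain ⟨r, hr⟩ := IsAlgClosed.exists_eq_mul_self (a * a + b * b)⁻¹
    exact ⟨r, by rw [← hr, inv_mul_cancel₀ h]⟩
  by_cases h01 : u 0 * u 0 + u 1 * u 1 = 0
  -- The three pairwise sums of squares add up to 2, so some coordinate pair is not isotropic.
  · have h12 : u 0 * u 0 + u 2 * u 2 ≠ 0 ∨ u 1 * u 1 + u 2 * u 2 ≠ 0 := by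
      by_contra! hc
      have : (2 : ℂ) = 0 := by linear_combination h01 + hc.1 + hc.2 - 2 * hu
      norm_num at this
    rcases h12 with h | h
    · obtain ⟨r, hr⟩ := key _ _ h
      refine ⟨![-(r * u 2), 0, r * u 0], ?_, ?_⟩ <;> simp
      · ring
      · linear_combination hr
    · obtain ⟨r, hr⟩ := key _ _ h
      refine ⟨![0, -(r * u 2), r * u 1], ?_, ?_⟩ <;> simp
      · ring
      · linear_combination hr
  · obtain ⟨r, hr⟩ := key _ _ h01
    refine ⟨![-(r * u 1), r * u 0, 0], ?_, ?_⟩ <;> simp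
    · ring
    · linear_combination hr

/-- A matrix whose axial vector has square `-1` can be rotated so that it points along the first
axis. -/
theorem exists_socongruent_axialVector {A : Matrix (Fin 3) (Fin 3) ℂ}
    (ha : axialVector A ⬝ᵥ axialVector A = -1) :
    ∃ B, SOCongruent A B ∧ axialVector B = ![-I, 0, 0] := by
  have hu : (I • axialVector A) ⬝ᵥ (I • axialVector A) = 1 := by
    rw [smul_dotProduct, dotProduct_smul, ha]; simp
  obtain ⟨v, huv, hv⟩ := exists_completion _ hu
  obtain ⟨u, hu'⟩ : ∃ u, I • axialVector A = u := ⟨_, rfl⟩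
  have hA : axialVector A = (-I) • u := by rw [← hu', smul_smul]; simp
  rw [hu'] at hu huv
  have a0 : A 2 1 - A 1 2 = -I * u 0 := by simpa [axialVector] using congrFun hA 0
  have a1 : A 0 2 - A 2 0 = -I * u 1 := by simpa [axialVector] using congrFun hA 1
  have a2 : A 1 0 - A 0 1 = -I * u 2 := by simpa [axialVector] using congrFun hA 2
  simp only [dotProduct, Fin.sum_univ_three] at hu huv hv
  generalize u 0 = u0, u 1 = u1, u 2 = u2, v 0 = v0, v 1 = v1, v 2 = v2 at *
  -- Lagrange's identity for `u × v`, the third column of `T`.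
  have hw : (u1 * v2 - u2 * v1) ^ 2 + (u2 * v0 - u0 * v2) ^ 2 + (u0 * v1 - u1 * v0) ^ 2 = 1 := by
    linear_combination hu + (u0 * u0 + u1 * u1 + u2 * u2) * hv - (u0 * v0 + u1 * v1 + u2 * v2) * huv
  refine ⟨_, SOCongruent.of_mul_transpose (T := !![u0, v0, u1 * v2 - u2 * v1;
    u1, v1, u2 * v0 - u0 * v2; u2, v2, u0 * v1 - u1 * v0]) ?_ ?_ rfl, ?_⟩
  · ext i j
    fin_cases i <;> fin_cases j <;> simp [Matrix.mul_apply, Fin.sum_univ_three]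
    · exact hu
    · exact huv
    · ring
    · linear_combination huv
    · exact hv
    · ring
    · ring
    · ring
    · linear_combination hw
  · rw [det_fin_three]
    simp
    linear_combination hw
  -- The new axial vector is `adj(T) a = Tᵀ a`, the products of `a = -i u` with `u`, `v`, `u × v`.
  · ext i
    fin_cases i <;> simp [axialVector, Matrix.mul_apply, Fin.sum_univ_three]
    · linear_combination (v1 * (u0 * v1 - u1 * v0) - v2 * (u2 * v0 - u0 * v2)) * a0 +
        (v2 * (u1 * v2 - u2 * v1) - v0 * (u0 * v1 - u1 * v0)) * a1 +
        (v0 * (u2 * v0 - u0 * v2) - v1 * (u1 * v2 - u2 * v1)) * a2 - I * hw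
    · linear_combination ((u2 * v0 - u0 * v2) * u2 - (u0 * v1 - u1 * v0) * u1) * a0 +
        ((u0 * v1 - u1 * v0) * u0 - (u1 * v2 - u2 * v1) * u2) * a1 +
        ((u1 * v2 - u2 * v1) * u1 - (u2 * v0 - u0 * v2) * u0) * a2
    · linear_combination (u1 * v2 - u2 * v1) * a0 + (u2 * v0 - u0 * v2) * a1 +
        (u0 * v1 - u1 * v0) * a2

/-! ### Block forms and their normalisation -/

/-- The normal form of a solution whose axial vector is `(-i, 0, 0)`. -/
noncomputable def blockForm (k p q : ℂ) : Matrix (Fin 3) (Fin 3) ℂ :=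
  !![k, 0, 0; 0, -(1 / 2) + p, I / 2 + q; 0, -(I / 2) + q, -(1 / 2) - p]

theorem IsSolution.exists_blockForm {A : Matrix (Fin 3) (Fin 3) ℂ} (h : IsSolution A)
    (ha : axialVector A = ![-I, 0, 0]) :
    ∃ k p q : ℂ, A = blockForm k p q ∧
      (p = 0 ∧ q = 0 ∨ k = -1 ∧ q = -I * p ∨ k = 0 ∧ q = I * p) := by
  have hv := h.mulVec_axialVector
  have v0 := congrFun hv 0
  have v1 := congrFun hv 1
  have v2 := congrFun hv 2
  have a0 : A 2 1 - A 1 2 = -I := by simpa [axialVector] using congrFun ha 0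
  have a1 : A 0 2 - A 2 0 = 0 := by simpa [axialVector] using congrFun ha 1
  have a2 : A 1 0 - A 0 1 = 0 := by simpa [axialVector] using congrFun ha 2
  simp [ha, Matrix.mulVec, dotProduct, Fin.sum_univ_three, trace_fin_three] at v0 v1 v2
  have h10 : A 1 0 = 0 := by linear_combination (1 / 2) * v1 + (1 / 2) * a2
  have h01 : A 0 1 = 0 := by linear_combination h10 - a2
  have h20 : A 2 0 = 0 := by linear_combination (1 / 2) * v2 - (1 / 2) * a1
  have h02 : A 0 2 = 0 := by linear_combination h20 + a1
  have htr : A 1 1 + A 2 2 = -1 := by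
    linear_combination (-1 / 2) * v0
  -- `p, q` are the coordinates of the trace-free symmetric part of the lower block.
  obtain ⟨p, hp⟩ : ∃ p, p = A 1 1 + 1 / 2 := ⟨_, rfl⟩
  obtain ⟨q, hq⟩ : ∃ q, q = A 1 2 - I / 2 := ⟨_, rfl⟩
  have h11 : A 1 1 = -(1 / 2) + p := by linear_combination -hp
  have h12 : A 1 2 = I / 2 + q := by linear_combination -hq
  have h22 : A 2 2 = -(1 / 2) - p := by linear_combination htr - h11
  have h21 : A 2 1 = -(I / 2) + q := by linear_combination a0 + h12
  obtain ⟨e00, e01, e02, e10, e11, e12, e20, e21, e22⟩ := h.entries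
  simp only [h10, h01, h20, h02, h11, h12, h22, h21] at e00 e11 e12 e21 e22
  refine ⟨A 0 0, p, q, ?_, ?_⟩
  · ext i j
    fin_cases i <;> fin_cases j <;> simp [blockForm, h10, h01, h20, h02, h11, h12, h22, h21]
  generalize A 0 0 = k at *
  have f1 : (2 * k + 1) * p = -I * q := by linear_combination (1 / 2) * (e11 - e22)
  have f2 : (2 * k + 1) * q = I * p := by linear_combination (1 / 2) * (e12 + e21)
  by_cases hp : p = 0
  · left
    refine ⟨hp, ?_⟩
    rw [hp] at f1
    simpa using f1
  -- Eliminating `q` from `f1`, `f2` gives `((2k + 1)² - 1) p = 0`.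
  · have hk : k * (k + 1) = 0 := by
      apply mul_right_cancel₀ hp
      linear_combination (1 / 4) * (2 * k + 1) * f1 - (I / 4) * f2 - (p / 4) * I_sq
    right
    rcases mul_eq_zero.1 hk with h0 | h0
    · right
      refine ⟨h0, ?_⟩
      linear_combination f2 - 2 * q * h0
    · left
      refine ⟨eq_neg_of_add_eq_zero_left h0, ?_⟩
      linear_combination -f2 + 2 * q * h0

/-- Rotation about the first axis multiplies `p + iq` by `(c + is)²` and `p - iq` by `(c - is)²`. On
the lines `q = ∓ip` one of these vanishes and `p` is simply rescaled. -/
theorem socongruent_blockForm_rotate (k p q : ℂ) {c s : ℂ} (h : c ^ 2 + s ^ 2 = 1) :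
    SOCongruent (blockForm k p q)
      (blockForm k (p * (c ^ 2 - s ^ 2) - 2 * q * c * s) (q * (c ^ 2 - s ^ 2) + 2 * p * c * s)) := by
  refine SOCongruent.of_mul_transpose (T := !![1, 0, 0; 0, c, s; 0, -s, c]) ?_ ?_ ?_
  · ext i j
    fin_cases i <;> fin_cases j <;> simp [Matrix.mul_apply, Fin.sum_univ_three]
    · linear_combination h
    · ring
    · ring
    · linear_combination h
  · rw [det_fin_three]
    simp
    linear_combination h
  · ext i j
    fin_cases i <;> fin_cases j <;> simp [blockForm, Matrix.mul_apply, Fin.sum_univ_three]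
    · linear_combination (1 / 2) * h
    · linear_combination (-I / 2) * h
    · linear_combination (I / 2) * h
    · linear_combination (1 / 2) * h

theorem exists_rotation_scaling {p P : ℂ} (hp : p ≠ 0) (hP : P ≠ 0) :
    ∃ c s : ℂ, c ^ 2 + s ^ 2 = 1 ∧ p * (c + I * s) ^ 2 = P := by
  obtain ⟨r, hr⟩ := IsAlgClosed.exists_eq_mul_self (P / p)
  have hr0 : r ≠ 0 := by
    rintro rfl
    simp [hp, hP] at hr
  -- Chosen so that `c + is = r` and `c - is = r⁻¹`.
  refine ⟨(r + r⁻¹) / 2, -I * (r - r⁻¹) / 2, ?_, ?_⟩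
  · field_simp
    linear_combination (r ^ 2 - 1) ^ 2 * I_sq
  · have : (r + r⁻¹) / 2 + I * (-I * (r - r⁻¹) / 2) = r := by
      linear_combination (-(r - r⁻¹) / 2) * I_sq
    rw [this, sq, ← hr, mul_div_cancel₀ _ hp]

theorem socongruent_blockForm_neg {k p P : ℂ} (hp : p ≠ 0) (hP : P ≠ 0) :
    SOCongruent (blockForm k p (-I * p)) (blockForm k P (-I * P)) := by
  obtain ⟨c, s, h, hs⟩ := exists_rotation_scaling hp hP
  convert socongruent_blockForm_rotate k p (-I * p) h using 2
  · linear_combination -hs + p * s ^ 2 * I_sq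
  · linear_combination I * hs - I * p * s ^ 2 * I_sq - 2 * p * c * s * I_sq

theorem socongruent_blockForm_pos {k p P : ℂ} (hp : p ≠ 0) (hP : P ≠ 0) :
    SOCongruent (blockForm k p (I * p)) (blockForm k P (I * P)) := by
  obtain ⟨c, s, h, hs⟩ := exists_rotation_scaling hp hP
  convert socongruent_blockForm_rotate k p (I * p) (c := c) (s := -s) (by simpa using h) using 2
  · linear_combination -hs + p * s ^ 2 * I_sq
  · linear_combination -I * hs + I * p * s ^ 2 * I_sq + 2 * p * c * s * I_sq

theorem blockForm_zero_zero (k : ℂ) : blockForm k 0 0 = (RepLabel.family k).toMatrix := by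
  simp [blockForm, RepLabel.toMatrix]

theorem blockForm_rankTwo : blockForm (-1) (-I / 2) (-I * (-I / 2)) = RepLabel.rankTwo.toMatrix := by
  ext i j
  fin_cases i <;> fin_cases j <;> simp [blockForm, RepLabel.toMatrix]
  · ring
  · linear_combination (1 / 2) * I_sq
  · linear_combination (1 / 2) * I_sq
  · ring

theorem socongruent_blockForm_rankOne :
    SOCongruent (blockForm 0 I (I * I)) RepLabel.rankOne.toMatrix := by
  -- A signed cyclic permutation moving the first axis to the third.
  refine SOCongruent.of_mul_transpose (T := !![0, 0, -1; 1, 0, 0; 0, -1, 0]) ?_ ?_ ?_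
  · ext i j
    fin_cases i <;> fin_cases j <;> simp [Matrix.mul_apply, Fin.sum_univ_three]
  · simp [det_fin_three]
  · ext i j
    fin_cases i <;> fin_cases j <;>
      simp [blockForm, RepLabel.toMatrix, Matrix.mul_apply, Fin.sum_univ_three] <;> ring

theorem IsSolution.exists_socongruent {A : Matrix (Fin 3) (Fin 3) ℂ} (h : IsSolution A) :
    ∃ r : RepLabel, SOCongruent A r.toMatrix := by
  by_cases ha : axialVector A = 0
  · rcases h.eq_zero_or_neg_one ha with rfl | rfl
    · refine ⟨.zero, ?_⟩
      convert SOCongruent.refl _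
      ext i j
      fin_cases i <;> fin_cases j <;> simp [RepLabel.toMatrix]
    · refine ⟨.negOne, ?_⟩
      convert SOCongruent.refl _
      ext i j
      fin_cases i <;> fin_cases j <;> simp [RepLabel.toMatrix]
  · obtain ⟨B, hAB, hB⟩ := exists_socongruent_axialVector (h.axialVector_dotProduct_self ha)
    obtain ⟨k, p, q, rfl, hc⟩ := (hAB.isSolution h).exists_blockForm hB
    by_cases hp : p = 0
    · have hq : q = 0 := by
        rcases hc with ⟨-, hq⟩ | ⟨-, hq⟩ | ⟨-, hq⟩ <;> simp [hq, hp]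
      subst hp hq
      exact ⟨.family k, by rwa [blockForm_zero_zero] at hAB⟩
    · rcases hc with ⟨hp', -⟩ | ⟨rfl, rfl⟩ | ⟨rfl, rfl⟩
      · exact absurd hp' hp
      · refine ⟨.rankTwo, hAB.trans ?_⟩
        rw [← blockForm_rankTwo]
        exact socongruent_blockForm_neg hp (by simp)
      · exact ⟨.rankOne, hAB.trans
          ((socongruent_blockForm_pos hp I_ne_zero).trans socongruent_blockForm_rankOne)⟩

/-! ### Non-congruence of the representatives -/

theorem RepLabel.trace_toMatrix (r : RepLabel) : r.toMatrix.trace =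
    match r with
    | .zero => 0
    | .negOne => -3
    | .rankTwo => -2
    | .family k => k - 1
    | .rankOne => -1 := by
  cases r <;> simp [RepLabel.toMatrix, trace_fin_three] <;> ring

theorem RepLabel.zero_toMatrix : RepLabel.zero.toMatrix = 0 := by
  ext i j
  fin_cases i <;> fin_cases j <;> simp [RepLabel.toMatrix]

theorem RepLabel.negOne_toMatrix : RepLabel.negOne.toMatrix = -1 := by
  ext i j
  fin_cases i <;> fin_cases j <;> simp [RepLabel.toMatrix]

theorem not_socongruent_zero_family (k : ℂ) :
    ¬ SOCongruent RepLabel.zero.toMatrix (RepLabel.family k).toMatrix := by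
  rintro ⟨T, -, h⟩
  rw [RepLabel.zero_toMatrix] at h
  simpa [RepLabel.toMatrix] using congrFun (congrFun h 1) 1

theorem not_socongruent_negOne_family (k : ℂ) :
    ¬ SOCongruent RepLabel.negOne.toMatrix (RepLabel.family k).toMatrix := by
  intro h
  obtain ⟨T, h1, -, -, h⟩ := h.exists_transpose
  rw [RepLabel.negOne_toMatrix] at h
  simpa [RepLabel.toMatrix, h1] using congrFun (congrFun h 1) 2

/-- Trace forces `k = -1`. Then `S = A + Aᵀ` is diagonal with eigenvalues -2, -1, -1, so `(S + 2)(S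
+ 1) = 0`, whereas the other matrix has a Jordan block at -1. -/
theorem not_socongruent_family_rankTwo (k : ℂ) :
    ¬ SOCongruent (RepLabel.family k).toMatrix RepLabel.rankTwo.toMatrix := by
  intro h
  have ht := h.trace_eq
  simp only [RepLabel.trace_toMatrix] at ht
  obtain rfl : k = -1 := by linear_combination ht
  have := h.symmetric_part_relation 2 (by
    ext i j
    fin_cases i <;> fin_cases j <;>
      simp [RepLabel.toMatrix, Matrix.mul_apply, Fin.sum_univ_three] <;> norm_num)
  have := congrFun (congrFun this 1) 2
  simp [RepLabel.toMatrix, Matrix.mul_apply, Fin.sum_univ_three] at this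
  have : (1 : ℂ) = 0 := by linear_combination -this
  exact one_ne_zero this

theorem not_socongruent_family_rankOne (k : ℂ) :
    ¬ SOCongruent (RepLabel.family k).toMatrix RepLabel.rankOne.toMatrix := by
  intro h
  have ht := h.trace_eq
  simp only [RepLabel.trace_toMatrix] at ht
  obtain rfl : k = 0 := by linear_combination ht
  -- Here `S = diag(0, -1, -1)`, hence the constant 0.
  have := h.symmetric_part_relation 0 (by
    ext i j
    fin_cases i <;> fin_cases j <;>
      simp [RepLabel.toMatrix, Matrix.mul_apply, Fin.sum_univ_three] <;> norm_num)
  have := congrFun (congrFun this 0) 1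
  simp [RepLabel.toMatrix, Matrix.mul_apply, Fin.sum_univ_three] at this
  have : (1 : ℂ) = 0 := by linear_combination (-1 / 2) * this
  exact one_ne_zero this

theorem RepLabel.not_socongruent {r s : RepLabel} (hrs : r ≠ s) :
    ¬ SOCongruent r.toMatrix s.toMatrix := by
  intro h
  have ht := h.trace_eq
  rw [RepLabel.trace_toMatrix, RepLabel.trace_toMatrix] at ht
  cases r <;> cases s
  case zero.zero | negOne.negOne | rankTwo.rankTwo | rankOne.rankOne => exact hrs rfl
  case family.family k l =>
    simp only [sub_left_inj] at ht
    exact hrs (by rw [ht])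
  case zero.family k => exact not_socongruent_zero_family k h
  case family.zero k => exact not_socongruent_zero_family k h.symm
  case negOne.family k => exact not_socongruent_negOne_family k h
  case family.negOne k => exact not_socongruent_negOne_family k h.symm
  case family.rankTwo k => exact not_socongruent_family_rankTwo k h
  case rankTwo.family k => exact not_socongruent_family_rankTwo k h.symm
  case family.rankOne k => exact not_socongruent_family_rankOne k h
  case rankOne.family k => exact not_socongruent_family_rankOne k h.symm
  all_goals norm_num at ht

/-! ### Ranks -/

theorem rank_rankTwo : RepLabel.rankTwo.toMatrix.rank = 2 := by
  apply le_antisymm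
  · have : RepLabel.rankTwo.toMatrix =
        (!![1, 0; 0, 1; 0, 1] : Matrix (Fin 3) (Fin 2) ℂ) *
          !![-1, 0, 0; 0, -((1 + I) / 2), (I - 1) / 2] := by
      ext i j
      fin_cases i <;> fin_cases j <;>
        simp [RepLabel.toMatrix, Matrix.mul_apply, Fin.sum_univ_two]
    rw [this]
    exact (rank_mul_le_right _ _).trans ((rank_le_card_height _).trans (by simp))
  · have : (!![1, 0, 0; 0, 1, 0] : Matrix (Fin 2) (Fin 3) ℂ) * RepLabel.rankTwo.toMatrix *
        (!![-1, 0; 0, I - 1; 0, 0] : Matrix (Fin 3) (Fin 2) ℂ) = 1 := by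
      ext i j
      fin_cases i <;> fin_cases j <;>
        simp [RepLabel.toMatrix, Matrix.mul_apply, Fin.sum_univ_three]
      linear_combination (-1 / 2) * I_sq
    calc 2 = (1 : Matrix (Fin 2) (Fin 2) ℂ).rank := by simp
      _ ≤ _ := by
        rw [← this]
        exact (rank_mul_le_left _ _).trans (rank_mul_le_right _ _)

theorem rank_rankOne : RepLabel.rankOne.toMatrix.rank = 1 := by
  apply le_antisymm
  · have : RepLabel.rankOne.toMatrix =
        vecMulVec ![-(1 / 2) + I, 1 + I / 2, 0] ![1, -(4 + 3 * I) / 5, 0] := by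
      ext i j
      fin_cases i <;> fin_cases j <;> simp [RepLabel.toMatrix, vecMulVec_apply]
      · linear_combination (3 / 5) * I_sq
      · linear_combination (3 / 10) * I_sq
    rw [this]
    exact rank_vecMulVec_le _ _
  -- The column holds the inverse of the corner entry `-1/2 + i`.
  · have : (!![1, 0, 0] : Matrix (Fin 1) (Fin 3) ℂ) * RepLabel.rankOne.toMatrix *
        (!![-(4 / 5) * (1 / 2 + I); 0; 0] : Matrix (Fin 3) (Fin 1) ℂ) = 1 := by
      ext i j
      fin_cases i; fin_cases j
      simp [RepLabel.toMatrix, Matrix.mul_apply, Fin.sum_univ_three]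
      linear_combination (-4 / 5) * I_sq
    calc 1 = (1 : Matrix (Fin 1) (Fin 1) ℂ).rank := by simp
      _ ≤ _ := by
        rw [← this]
        exact (rank_mul_le_left _ _).trans (rank_mul_le_right _ _)

theorem theorem3 :
    -- the solutions are exactly the matrices congruent to a member of the list
    (∀ A : Matrix (Fin 3) (Fin 3) ℂ,
      IsSolution A ↔ ∃ r : RepLabel, SOCongruent A r.toMatrix) ∧
    -- different members of the list are not congruent
    (∀ r s : RepLabel, r ≠ s → ¬ SOCongruent r.toMatrix s.toMatrix) ∧
    -- the ranks of the two isolated singular nonzero representatives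
    RepLabel.rankTwo.toMatrix.rank = 2 ∧
    RepLabel.rankOne.toMatrix.rank = 1 ∧
    -- congruent matrices have equal traces, and members of the family have different traces
    (∀ A B : Matrix (Fin 3) (Fin 3) ℂ, SOCongruent A B → A.trace = B.trace) ∧
    (∀ k l : ℂ, k ≠ l →
      (RepLabel.family k).toMatrix.trace ≠ (RepLabel.family l).toMatrix.trace) := by
  refine ⟨fun A => ⟨fun h => h.exists_socongruent, ?_⟩, fun r s => RepLabel.not_socongruent,
    rank_rankTwo, rank_rankOne, fun A B h => h.trace_eq, ?_⟩
  · rintro ⟨r, hr⟩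
    exact hr.symm.isSolution r.isSolution_toMatrix
  · intro k l hkl h
    simp only [RepLabel.trace_toMatrix, sub_left_inj] at h
    exact hkl h
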